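/- For $\kappa\in\mathbb{C}$ let $E_\kappa:\mathbb{C}\to\mathbb{C}$, $E_\kappa(z)=\exp(z)+\kappa$, and let $I(E_\kappa)=\{z\in\mathbb{C} : |E_\kappa^n(z)|\to\infty \text{ as } n\to\infty\}$ be its escaping set, equipped with the subspace topology of $\mathbb{C}$; note that $E_\kappa(I(E_\kappa))\subset I(E_\kappa)$. Let $\widetilde\kappa=\log(2\pi)+\frac{\pi}{2}i$. Then the restrictions $E_{-2}|_{I(E_{-2})}$ and $E_{\widetilde\kappa}|_{I(E_{\widetilde\kappa})}$ are not topologically conjugate; that is, there is no homeomorphism $\Phi:I(E_{-2})\to I(E_{\widetilde\kappa})$ with $\Phi\circ E_{-2}=E_{\widetilde\kappa}\circ\Phi$ on $I(E_{-2})$. -/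

import Mathlib

open Filter

/-- The exponential map `E_κ : z ↦ exp z + κ`. -/
noncomputable def expMap (κ : ℂ) : ℂ → ℂ := fun z => Complex.exp z + κ

/-- The escaping set of `f`: the points whose orbit under `f` tends to `∞`. -/
def escapingSet (f : ℂ → ℂ) : Set ℂ :=
  {z | Tendsto (fun n : ℕ => ‖f^[n] z‖) atTop atTop}

theorem mapsTo_escapingSet (f : ℂ → ℂ) : Set.MapsTo f (escapingSet f) (escapingSet f) := by
  intro z hz
  have h : Tendsto (fun n : ℕ => ‖f^[n + 1] z‖) atTop atTop := (tendsto_add_atTop_iff_nat 1).2 hz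
  exact h

/-- The restriction `f|_I : I → I` of `f` to its escaping set `I` (with the subspace topology). -/
def escapingRestrict (f : ℂ → ℂ) : escapingSet f → escapingSet f :=
  (mapsTo_escapingSet f).restrict f (escapingSet f) (escapingSet f)

/-- Two self-maps are topologically conjugate if some homeomorphism `Φ` satisfies `Φ ∘ f = g ∘ Φ`. -/
def TopologicallyConjugate {X Y : Type*} [TopologicalSpace X] [TopologicalSpace Y]
    (f : X → X) (g : Y → Y) : Prop :=
  ∃ Φ : X ≃ₜ Y, Function.Semiconj Φ f g

section

open Complex Topology

/-! A conjugacy transports a continuous right inverse of one restricted map to the other. For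
`E_{-2}` one exists (`exists_continuous_section_neg_two`): the half plane `Re z < 0` is mapped into
a bounded part of itself, so escaping points have `Re z ≥ 0` and `log (z + 2)` works. For the second
parameter `exp κ = 2πi`, so translation by `κ` turns `E_κ` into `misMap`, and a right inverse
becomes a continuous logarithm `ℓ` on the escaping set of `misMap`.
`not_exists_continuousOn_log_escapingSet` excludes this.

The singular value `0` is sent to the fixed point `2πi`. An escaping curve `ray` lands at `2πi`, so
its translate `ray - 2πi` lands at `0`, and a preimage `γ` of the translate runs from real part `-∞`
to `+∞`, passing between `0` and `2πi` (`exists_isSeparatingCurve`). The pullback of `γ` by `misInv`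
bends around `2πi` with both ends going right. Further pullbacks contract, so points on opposite
ends can be brought close to `ray 20` (`norm_lift_sub_ray_le`). Following a logarithm of `w - 2πi`
along the pullback from one point to the other changes its imaginary part by about `2π` or more
(`liftLog_zero_im_left`, `liftLog_zero_im_right`, `liftLog_im_sub_arg`). By `2πi`-periodicity `w -
2πi` escapes as well, so this contradicts continuity of `ℓ` at `ray 20 - 2πi`. -/

theorem exists_int_of_exp_eq_exp {s : Set ℝ} (hs : IsPreconnected s) (hne : s.Nonempty)
    {a b : ℝ → ℂ} (ha : ContinuousOn a s) (hb : ContinuousOn b s)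
    (h : ∀ x ∈ s, exp (a x) = exp (b x)) :
    ∃ k : ℤ, ∀ x ∈ s, a x = b x + k * (2 * Real.pi * I) := by
  have hpi : (2 * Real.pi * I : ℂ) ≠ 0 := Complex.two_pi_I_ne_zero
  obtain ⟨x₀, hx₀⟩ := hne
  have key : ∀ x ∈ s, ∃ k : ℤ, (a x - b x) / (2 * Real.pi * I) = k := by
    intro x hx
    obtain ⟨k, hk⟩ := Complex.exp_eq_exp_iff_exists_int.1 (h x hx)
    refine ⟨k, ?_⟩
    rw [hk]
    field_simp
    ring
  have hc : ContinuousOn (fun x => ((a x - b x) / (2 * Real.pi * I)).re) s :=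
    Complex.continuous_re.comp_continuousOn ((ha.sub hb).div_const _)
  have hT : IsDiscrete (Set.range (Int.cast : ℤ → ℝ)) :=
    Int.isClosedEmbedding_coe_real.isInducing.isDiscrete_range
  obtain ⟨y, ⟨k, rfl⟩, hy⟩ := hs.eqOn_const_of_mapsTo hT hc
    (fun x hx => by
      obtain ⟨k, hk⟩ := key x hx
      exact ⟨k, by simp [hk]⟩) ⟨0, 0, by simp⟩
  refine ⟨k, fun x hx => ?_⟩
  obtain ⟨j, hj⟩ := key x hx
  have h1 := hy hx
  simp only [hj, Complex.intCast_re, Function.const_apply, Int.cast_inj] at h1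
  rw [h1, div_eq_iff hpi] at hj
  linear_combination hj

/-! ### The difference quotient of the logarithm at `1` -/

namespace Complex

theorem exists_im_eq_arg_add {u a : ℂ} (h : exp u = a) :
    ∃ k : ℤ, u.im = a.arg + k * (2 * Real.pi) := by
  have ha : a ≠ 0 := h ▸ exp_ne_zero u
  obtain ⟨k, hk⟩ := exp_eq_exp_iff_exists_int.1 (h.trans (exp_log ha).symm)
  refine ⟨k, ?_⟩
  have := congrArg im hk
  simpa [log_im] using this

/-- The quotient `log v / (v - 1)`, extended by `1` at `v = 1`. -/
noncomputable def logSlope (v : ℂ) : ℂ := dslope log 1 v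

theorem sub_one_mul_logSlope (v : ℂ) : (v - 1) * logSlope v = log v := by
  have := sub_smul_dslope log 1 v
  simpa [logSlope] using this

theorem continuousOn_logSlope : ContinuousOn logSlope slitPlane := by
  refine (continuousOn_dslope (isOpen_slitPlane.mem_nhds one_mem_slitPlane)).2 ⟨?_, ?_⟩
  · exact fun v hv => (continuousAt_clog hv).continuousWithinAt
  · exact (hasStrictDerivAt_log one_mem_slitPlane).hasDerivAt.differentiableAt

theorem one_add_mul_sub_one_mem_slitPlane {v : ℂ} (hv : v ∈ slitPlane) {t : ℝ}
    (h0 : 0 ≤ t) (h1 : t ≤ 1) : 1 + t • (v - 1) ∈ slitPlane := by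
  have := (starConvex_one_slitPlane).add_smul_sub_mem hv h0 h1
  simpa using this

theorem logSlope_eq_integral {v : ℂ} (hv : v ∈ slitPlane) :
    logSlope v = ∫ t : ℝ in (0 : ℝ)..1, (1 + t • (v - 1))⁻¹ := by
  rcases eq_or_ne v 1 with rfl | h
  · simp [logSlope, dslope_same, (hasStrictDerivAt_log one_mem_slitPlane).hasDerivAt.deriv]
  · have h1 := sub_one_mul_logSlope v
    have h2 := log_eq_integral (z := v - 1) (by simpa using hv)
    rw [add_sub_cancel] at h2
    rw [h2] at h1
    exact mul_left_cancel₀ (sub_ne_zero.2 h) h1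

theorem continuousOn_logSlope_integrand {v : ℂ} (hv : v ∈ slitPlane) :
    ContinuousOn (fun t : ℝ => (1 + t • (v - 1))⁻¹) (Set.uIcc 0 1) := by
  refine ContinuousOn.inv₀ (by fun_prop) fun t ht => ?_
  rw [Set.uIcc_of_le zero_le_one] at ht
  exact slitPlane_ne_zero (one_add_mul_sub_one_mem_slitPlane hv ht.1 ht.2)

/-- Inversion preserves the right half plane, which contains the segment from `1` to `v`; integrate.
-/
theorem logSlope_re_pos {v : ℂ} (hv : 0 < v.re) : 0 < (logSlope v).re := by
  have hv' : v ∈ slitPlane := Or.inl hv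
  have hc := continuousOn_logSlope_integrand hv'
  have h := reCLM.intervalIntegral_comp_comm (μ := MeasureTheory.volume)
    hc.intervalIntegrable
  rw [logSlope_eq_integral hv', ← reCLM_apply, ← h]
  refine intervalIntegral.intervalIntegral_pos_of_pos_on
    (reCLM.continuous.comp_continuousOn hc).intervalIntegrable (fun t ht => ?_) one_pos
  have hne := slitPlane_ne_zero (one_add_mul_sub_one_mem_slitPlane hv' ht.1.le ht.2.le)
  rw [reCLM_apply, inv_re]
  refine div_pos ?_ (normSq_pos.2 hne)
  simp
  nlinarith [ht.1, ht.2]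

/-- Inversion flips the sign of the imaginary part at every point of the segment other than `1`. -/
theorem logSlope_im_neg {v : ℂ} (hv : 0 < v.im) : (logSlope v).im < 0 := by
  have hv' : v ∈ slitPlane := Or.inr hv.ne'
  have hc := continuousOn_logSlope_integrand hv'
  have h := (-imCLM).intervalIntegral_comp_comm (μ := MeasureTheory.volume)
    hc.intervalIntegrable
  have : 0 < (-imCLM : ℂ →L[ℝ] ℝ) (logSlope v) := by
    rw [logSlope_eq_integral hv', ← h]
    refine intervalIntegral.intervalIntegral_pos_of_pos_on
      ((-imCLM).continuous.comp_continuousOn hc).intervalIntegrable (fun t ht => ?_) one_pos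
    have hne := slitPlane_ne_zero (one_add_mul_sub_one_mem_slitPlane hv' ht.1.le ht.2.le)
    have : 0 < (1 + t • (v - 1)).im / normSq (1 + t • (v - 1)) := by
      refine div_pos ?_ (normSq_pos.2 hne)
      simpa using mul_pos ht.1 hv
    rw [neg_apply, imCLM_apply, inv_im, neg_div, neg_neg]
    exact this
  simpa using this

theorem logSlope_im_pos {v : ℂ} (hv : v.im < 0) : 0 < (logSlope v).im := by
  have hv' : v ∈ slitPlane := Or.inr hv.ne
  have hc := continuousOn_logSlope_integrand hv'
  have h := imCLM.intervalIntegral_comp_comm (μ := MeasureTheory.volume)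
    hc.intervalIntegrable
  rw [logSlope_eq_integral hv', ← imCLM_apply, ← h]
  refine intervalIntegral.intervalIntegral_pos_of_pos_on
    (imCLM.continuous.comp_continuousOn hc).intervalIntegrable (fun t ht => ?_) one_pos
  have hne := slitPlane_ne_zero (one_add_mul_sub_one_mem_slitPlane hv' ht.1.le ht.2.le)
  rw [imCLM_apply, inv_im]
  refine div_pos ?_ (normSq_pos.2 hne)
  simpa using mul_neg_of_pos_of_neg ht.1 hv

theorem logSlope_mem_slitPlane {v : ℂ} (hv : v ∈ slitPlane) : logSlope v ∈ slitPlane := by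
  rcases lt_trichotomy v.im 0 with h | h | h
  · exact Or.inr (logSlope_im_pos h).ne'
  · exact Or.inl (logSlope_re_pos (hv.resolve_right (not_not.2 h)))
  · exact Or.inr (logSlope_im_neg h).ne

end Complex

/-! ### The model map and its inverse branch at `2πi` -/

/-- The fixed point `2πi` of `w ↦ 2πi exp w`. -/
noncomputable def misFixed : ℂ := 2 * Real.pi * I

/-- The map `w ↦ 2πi exp w`, an affine conjugate of `E_κ` for `exp κ = 2πi`. -/
noncomputable def misMap (w : ℂ) : ℂ := misFixed * exp w

/-- The inverse branch of `misMap` that fixes `2πi`. -/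
noncomputable def misInv (w : ℂ) : ℂ := log (w / misFixed) + misFixed

/-- A logarithm of the difference quotient of `misInv` at the fixed point. -/
noncomputable def misQuot (w : ℂ) : ℂ := log (logSlope (w / misFixed)) - log misFixed

@[simp] theorem misFixed_re : misFixed.re = 0 := by simp [misFixed]

@[simp] theorem misFixed_im : misFixed.im = 2 * Real.pi := by simp [misFixed]

theorem misFixed_ne_zero : misFixed ≠ 0 := two_pi_I_ne_zero

@[simp] theorem norm_misFixed : ‖misFixed‖ = 2 * Real.pi := by
  simp [misFixed, abs_of_pos Real.pi_pos]

theorem arg_misFixed : arg misFixed = Real.pi / 2 := by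
  rw [misFixed, show (2 * Real.pi * I : ℂ) = ((2 * Real.pi : ℝ) : ℂ) * I by push_cast; ring,
    arg_real_mul _ Real.two_pi_pos, arg_I]

theorem div_misFixed_re (w : ℂ) : (w / misFixed).re = w.im / (2 * Real.pi) := by
  have := Real.pi_pos
  simp [div_re, normSq_apply]
  field_simp

theorem div_misFixed_im (w : ℂ) : (w / misFixed).im = -w.re / (2 * Real.pi) := by
  have := Real.pi_pos
  simp [div_im, normSq_apply]
  field_simp

theorem div_misFixed_re_pos {w : ℂ} (hw : 0 < w.im) : 0 < (w / misFixed).re := by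
  rw [div_misFixed_re]; exact div_pos hw Real.two_pi_pos

theorem div_misFixed_mem_slitPlane {w : ℂ} (hw : 0 < w.im) : w / misFixed ∈ slitPlane :=
  Or.inl (div_misFixed_re_pos hw)

theorem misMap_misInv {w : ℂ} (hw : w ≠ 0) : misMap (misInv w) = w := by
  rw [misMap, misInv, exp_add, exp_log (div_ne_zero hw misFixed_ne_zero), misFixed,
    exp_two_pi_mul_I, mul_one, mul_div_cancel₀]
  exact two_pi_I_ne_zero

theorem misMap_sub_misFixed (w : ℂ) : misMap (w - misFixed) = misMap w := by
  rw [misMap, misMap, misFixed, exp_sub, exp_two_pi_mul_I, div_one]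

theorem misInv_misFixed : misInv misFixed = misFixed := by
  simp [misInv, div_self misFixed_ne_zero]

theorem misInv_im (w : ℂ) : (misInv w).im = arg (w / misFixed) + 2 * Real.pi := by
  simp [misInv, log_im]

theorem misInv_re (w : ℂ) : (misInv w).re = Real.log (‖w‖ / (2 * Real.pi)) := by
  simp [misInv, log_re]

theorem misInv_im_mem {w : ℂ} (hw : 0 < w.im) :
    3 * Real.pi / 2 < (misInv w).im ∧ (misInv w).im < 5 * Real.pi / 2 := by
  have h := abs_arg_lt_pi_div_two_iff.2 (Or.inl (div_misFixed_re_pos hw))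
  rw [abs_lt] at h
  rw [misInv_im]
  constructor <;> linarith [h.1, h.2]

theorem misInv_im_lt {w : ℂ} (hw : 0 < w.re) : (misInv w).im < 2 * Real.pi := by
  have : arg (w / misFixed) < 0 := by
    rw [arg_neg_iff, div_misFixed_im]
    exact div_neg_of_neg_of_pos (neg_neg_of_pos hw) Real.two_pi_pos
  rw [misInv_im]; linarith

theorem neg_one_lt_misInv_re {w : ℂ} (hw : 3 * Real.pi / 2 < w.im) : -1 < (misInv w).re := by
  have hpi := Real.pi_pos
  have h1 : 3 * Real.pi / 2 ≤ ‖w‖ := hw.le.trans ((le_abs_self _).trans (abs_im_le_norm w))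
  have h2 : 0 < ‖w‖ / (2 * Real.pi) := div_pos (by linarith) (by linarith)
  have h3 := Real.one_sub_inv_le_log_of_pos h2
  rw [misInv_re]
  -- `‖w‖ ≥ 3π/2` makes the ratio at least `3/4`, so its logarithm is at least `1 - 4/3`.
  have h4 : (‖w‖ / (2 * Real.pi))⁻¹ ≤ 4 / 3 := by
    rw [inv_div, div_le_iff₀ (by linarith)]; linarith
  linarith

theorem continuousAt_misInv {w : ℂ} (hw : w / misFixed ∈ slitPlane) : ContinuousAt misInv w :=
  ((continuousAt_id.div_const _).clog hw).add continuousAt_const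

/-- The derivative of `misInv` is `1/w`, and `‖w‖ ≥ Im w ≥ π` on this convex half plane. -/
theorem norm_misInv_sub_le {w w' : ℂ} (hw : Real.pi ≤ w.im) (hw' : Real.pi ≤ w'.im) :
    ‖misInv w - misInv w'‖ ≤ Real.pi⁻¹ * ‖w - w'‖ := by
  have hpi := Real.pi_pos
  have hconv : Convex ℝ {z : ℂ | Real.pi ≤ z.im} := convex_halfSpace_im_ge _
  refine hconv.norm_image_sub_le_of_norm_hasDerivWithin_le (f' := fun z => z⁻¹)
    (fun z hz => ?_) (fun z hz => ?_) hw' hw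
  · have hz' : z / misFixed ∈ slitPlane := div_misFixed_mem_slitPlane (hpi.trans_le hz)
    have hz0 : z ≠ 0 := fun h => by simp [h] at hz; linarith
    have h := (((hasDerivAt_id z).div_const misFixed).clog hz').add_const misFixed
    have h' : HasDerivAt misInv (1 / misFixed / (z / misFixed)) z := h
    convert! h'.hasDerivWithinAt using 1
    field_simp [misFixed_ne_zero]
  · rw [norm_inv]
    exact inv_anti₀ hpi ((hz.trans (le_abs_self _)).trans (abs_im_le_norm z))

/-- With `v = w / 2πi`, the left side is `log v = (v - 1) * logSlope v`, and `v - 1 = (w - 2πi) /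
2πi`. -/
theorem misInv_sub_misFixed {w : ℂ} (hw : w / misFixed ∈ slitPlane) :
    misInv w - misFixed = (w - misFixed) * exp (misQuot w) := by
  rw [misQuot, exp_sub, exp_log (slitPlane_ne_zero (logSlope_mem_slitPlane hw)),
    exp_log misFixed_ne_zero, misInv, add_sub_cancel_right, ← sub_one_mul_logSlope]
  field_simp [misFixed_ne_zero]

theorem continuousAt_misQuot {w : ℂ} (hw : w / misFixed ∈ slitPlane) :
    ContinuousAt misQuot w := by
  have h1 : ContinuousAt logSlope (w / misFixed) :=
    continuousOn_logSlope.continuousAt (isOpen_slitPlane.mem_nhds hw)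
  have h2 : ContinuousAt (fun z => logSlope (z / misFixed)) w :=
    ContinuousAt.comp (g := logSlope) (f := fun z : ℂ => z / misFixed) h1
      (continuousAt_id.div_const _)
  exact (h2.clog (logSlope_mem_slitPlane hw)).sub continuousAt_const

theorem misQuot_im (w : ℂ) :
    (misQuot w).im = arg (logSlope (w / misFixed)) - Real.pi / 2 := by
  rw [misQuot, sub_im, log_im, log_im, arg_misFixed]

theorem misQuot_im_mem {w : ℂ} (hw : 0 < w.im) :
    -Real.pi < (misQuot w).im ∧ (misQuot w).im < 0 := by
  have h := abs_arg_lt_pi_div_two_iff.2 (Or.inl (logSlope_re_pos (div_misFixed_re_pos hw)))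
  rw [abs_lt] at h
  rw [misQuot_im]
  constructor <;> linarith [h.1, h.2]

theorem abs_arg_sub_misFixed_lt {w : ℂ} (hw : 0 < w.re) :
    -(Real.pi / 2) < arg (w - misFixed) ∧ arg (w - misFixed) < Real.pi / 2 :=
  abs_lt.1 (abs_arg_lt_pi_div_two_iff.2 (Or.inl (by simpa using hw)))

theorem int_eq_zero_of_abs_lt {k : ℤ} (h1 : -(2 * Real.pi) < k * (2 * Real.pi))
    (h2 : k * (2 * Real.pi) < 2 * Real.pi) : k = 0 := by
  have hpi := Real.two_pi_pos
  have a : (-1 : ℝ) < k := by nlinarith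
  have b : (k : ℝ) < 1 := by nlinarith
  have a' : -1 < k := by exact_mod_cast a
  have b' : k < 1 := by exact_mod_cast b
  omega

theorem sub_misFixed_ne_zero {w : ℂ} (hw : 0 < w.re) : w - misFixed ≠ 0 := fun h => by
  have := congrArg re h
  simp at this
  linarith

/-- The sides agree modulo `2π`. Both arguments lie in `(-π/2, π/2)` and `Im misQuot` in `(-π, 0)`,
which leaves no room for a full turn. -/
theorem arg_misInv_sub {w : ℂ} (hi : 0 < w.im) (hr : 0 < w.re) (hr' : 0 < (misInv w).re) :
    arg (misInv w - misFixed) = arg (w - misFixed) + (misQuot w).im := by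
  have h : exp (log (w - misFixed) + misQuot w) = misInv w - misFixed := by
    rw [exp_add, exp_log (sub_misFixed_ne_zero hr),
      misInv_sub_misFixed (div_misFixed_mem_slitPlane hi)]
  obtain ⟨k, hk⟩ := exists_im_eq_arg_add h
  rw [add_im, log_im] at hk
  have h1 := abs_arg_sub_misFixed_lt hr
  have h2 := abs_arg_sub_misFixed_lt hr'
  have h3 := misQuot_im_mem hi
  have hk0 := int_eq_zero_of_abs_lt (k := k) (by linarith) (by linarith [Real.pi_pos])
  rw [hk0] at hk
  push_cast at hk
  linarith

/-! ### Construction of the ray landing at `2πi` -/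

/-- The growth model `x ↦ 2π(eˣ - 1)` on `[0, ∞)`. -/
noncomputable def growth (x : ℝ) : ℝ := 2 * Real.pi * (Real.exp x - 1)

theorem growth_zero : growth 0 = 0 := by simp [growth]

theorem two_mul_le_growth {x : ℝ} (hx : 0 ≤ x) : 2 * x ≤ growth x := by
  have h1 := Real.add_one_le_exp x
  have h2 := Real.pi_gt_three
  rw [growth]
  nlinarith

theorem growth_nonneg {x : ℝ} (hx : 0 ≤ x) : 0 ≤ growth x := by
  linarith [two_mul_le_growth hx]

theorem growth_pos {x : ℝ} (hx : 0 < x) : 0 < growth x := by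
  linarith [two_mul_le_growth hx.le]

theorem continuous_growth : Continuous growth := by unfold growth; fun_prop

theorem iterate_growth_nonneg {x : ℝ} (hx : 0 ≤ x) (n : ℕ) : 0 ≤ growth^[n] x := by
  induction n generalizing x with
  | zero => exact hx
  | succ n ih => exact ih (growth_nonneg hx)

theorem two_pow_mul_le_iterate_growth {x : ℝ} (hx : 0 ≤ x) (n : ℕ) :
    2 ^ n * x ≤ growth^[n] x := by
  induction n generalizing x with
  | zero => simp
  | succ n ih =>
    have h1 := ih (growth_nonneg hx)
    have h2 := two_mul_le_growth hx
    have h3 : (0 : ℝ) < 2 ^ n := by positivity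
    rw [Function.iterate_succ_apply, pow_succ]
    nlinarith

theorem tendsto_iterate_growth {x : ℝ} (hx : 0 < x) :
    Tendsto (fun n => growth^[n] x) atTop atTop :=
  tendsto_atTop_mono (two_pow_mul_le_iterate_growth hx.le)
    ((tendsto_pow_atTop_atTop_of_one_lt one_lt_two).atTop_mul_const hx)

theorem le_iterate_growth {x : ℝ} (hx : 0 ≤ x) (n : ℕ) : x ≤ growth^[n] x := by
  refine le_trans ?_ (two_pow_mul_le_iterate_growth hx n)
  nlinarith [one_le_pow₀ (n := n) (one_le_two : (1 : ℝ) ≤ 2)]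

theorem pi_le_iterate_misInv_im {w : ℂ} (hw : Real.pi ≤ w.im) (n : ℕ) :
    Real.pi ≤ (misInv^[n] w).im := by
  cases n with
  | zero => exact hw
  | succ n =>
    induction n generalizing w with
    | zero =>
      change Real.pi ≤ (misInv w).im
      linarith [(misInv_im_mem (Real.pi_pos.trans_le hw)).1, Real.pi_pos]
    | succ n ih =>
      exact ih (w := misInv w)
        (by linarith [(misInv_im_mem (Real.pi_pos.trans_le hw)).1, Real.pi_pos])

theorem norm_iterate_misInv_sub_le {w w' : ℂ} (hw : Real.pi ≤ w.im) (hw' : Real.pi ≤ w'.im)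
    (n : ℕ) : ‖misInv^[n] w - misInv^[n] w'‖ ≤ Real.pi⁻¹ ^ n * ‖w - w'‖ := by
  induction n with
  | zero => simp
  | succ n ih =>
    rw [Function.iterate_succ_apply', Function.iterate_succ_apply']
    refine (norm_misInv_sub_le (pi_le_iterate_misInv_im hw n)
      (pi_le_iterate_misInv_im hw' n)).trans ?_
    rw [pow_succ', mul_assoc]
    exact mul_le_mul_of_nonneg_left ih (inv_nonneg.2 Real.pi_pos.le)

theorem pi_inv_lt : Real.pi⁻¹ < 1 / 3 := by
  rw [one_div]
  exact inv_strictAnti₀ (by norm_num) Real.pi_gt_three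

/-- Approximations of the invariant curve that lands at `2πi`. -/
noncomputable def rayApprox (n : ℕ) (x : ℝ) : ℂ := misInv^[n] (growth^[n] x + misFixed)

/-- The curve that `misMap` maps into itself as `growth` maps `[0, ∞)`. -/
noncomputable def ray (x : ℝ) : ℂ := limUnder atTop fun n => rayApprox n x

theorem pi_le_im_ofReal_add (y : ℝ) : Real.pi ≤ ((y : ℂ) + misFixed).im := by
  simp
  linarith [Real.pi_pos]

theorem norm_growth_add (y : ℝ) (hy : 0 ≤ y) :
    Real.exp y / 2 ≤ ‖(growth y : ℂ) + misFixed‖ / (2 * Real.pi) ∧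
      ‖(growth y : ℂ) + misFixed‖ / (2 * Real.pi) ≤ Real.exp y := by
  have hpi := Real.pi_pos
  have he := Real.one_le_exp hy
  have h1 : ‖(growth y : ℂ) + misFixed‖ ≤ growth y + 2 * Real.pi := by
    refine (norm_add_le _ _).trans ?_
    rw [norm_misFixed, norm_real, Real.norm_of_nonneg (growth_nonneg hy)]
  have h2 := abs_re_le_norm ((growth y : ℂ) + misFixed)
  have h3 := abs_im_le_norm ((growth y : ℂ) + misFixed)
  rw [add_re, ofReal_re, misFixed_re, add_zero, abs_of_nonneg (growth_nonneg hy)] at h2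
  rw [add_im, ofReal_im, misFixed_im, zero_add, abs_of_pos Real.two_pi_pos] at h3
  have hg : growth y = 2 * Real.pi * (Real.exp y - 1) := rfl
  rw [le_div_iff₀ (by linarith), div_le_iff₀ (by linarith)]
  constructor
  · nlinarith
  · refine h1.trans (le_of_eq ?_)
    rw [hg]; ring

/-- The real parts differ by at most `log 2 < 1`, the imaginary parts by at most `π/2 < 2`. -/
theorem norm_misInv_growth_sub_le {y : ℝ} (hy : 0 ≤ y) :
    ‖misInv (growth y + misFixed) - (y + misFixed)‖ ≤ 3 := by
  have hn := norm_growth_add y hy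
  have hpos : 0 < Real.exp y / 2 := by positivity
  have him := misInv_im_mem (Real.pi_pos.trans_le (pi_le_im_ofReal_add (growth y)))
  have h1 : |(misInv (growth y + misFixed) - (y + misFixed)).re| ≤ 1 := by
    rw [sub_re, misInv_re, add_re, ofReal_re, misFixed_re, add_zero, abs_le]
    have a := Real.log_le_log hpos hn.1
    have b := Real.log_le_log (hpos.trans_le hn.1) hn.2
    rw [Real.log_div (Real.exp_pos y).ne' two_ne_zero, Real.log_exp] at a
    rw [Real.log_exp] at b
    constructor <;> linarith [Real.log_two_lt_d9]
  have h2 : |(misInv (growth y + misFixed) - (y + misFixed)).im| ≤ 2 := by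
    rw [sub_im, add_im, ofReal_im, misFixed_im, abs_le]
    constructor <;> linarith [Real.pi_lt_d2, him.1, him.2]
  linarith [norm_le_abs_re_add_abs_im (misInv (growth y + misFixed) - (y + misFixed))]

theorem dist_rayApprox_succ_le {x : ℝ} (hx : 0 ≤ x) (n : ℕ) :
    dist (rayApprox n x) (rayApprox (n + 1) x) ≤ 3 * Real.pi⁻¹ ^ n := by
  have hy := iterate_growth_nonneg hx n
  have h2 := pi_le_im_ofReal_add (growth (growth^[n] x))
  have h3 := misInv_im_mem (Real.pi_pos.trans_le h2)
  rw [dist_comm, dist_eq_norm, rayApprox, rayApprox, Function.iterate_succ_apply,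
    Function.iterate_succ_apply' growth]
  refine (norm_iterate_misInv_sub_le (by linarith [Real.pi_pos]) (pi_le_im_ofReal_add _) n).trans ?_
  rw [mul_comm]
  exact mul_le_mul_of_nonneg_right (norm_misInv_growth_sub_le hy)
    (pow_nonneg (inv_nonneg.2 Real.pi_pos.le) n)

theorem tendsto_rayApprox {x : ℝ} (hx : 0 ≤ x) :
    Tendsto (fun n => rayApprox n x) atTop (𝓝 (ray x)) :=
  (cauchySeq_of_le_geometric _ _ (by linarith [pi_inv_lt])
    (dist_rayApprox_succ_le hx)).tendsto_limUnder

theorem dist_rayApprox_ray_le {x : ℝ} (hx : 0 ≤ x) (n : ℕ) :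
    dist (rayApprox n x) (ray x) ≤ 5 * Real.pi⁻¹ ^ n := by
  have hp := pi_inv_lt
  have hq : (0 : ℝ) ≤ Real.pi⁻¹ ^ n := pow_nonneg (inv_nonneg.2 Real.pi_pos.le) n
  refine (dist_le_of_le_geometric_of_tendsto _ _ (by linarith) (dist_rayApprox_succ_le hx)
    (tendsto_rayApprox hx) n).trans ?_
  rw [div_le_iff₀ (by linarith)]
  nlinarith

theorem pi_le_ray_im {x : ℝ} (hx : 0 ≤ x) : Real.pi ≤ (ray x).im :=
  ge_of_tendsto ((continuous_im.tendsto _).comp (tendsto_rayApprox hx))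
    (Eventually.of_forall fun n => pi_le_iterate_misInv_im (pi_le_im_ofReal_add _) n)

/-- Limit of the identity `rayApprox (n + 1) x = misInv (rayApprox n (growth x))`. -/
theorem ray_eq {x : ℝ} (hx : 0 ≤ x) : ray x = misInv (ray (growth x)) := by
  have h1 := (tendsto_rayApprox hx).comp (tendsto_add_atTop_nat 1)
  have hc : ContinuousAt misInv (ray (growth x)) := continuousAt_misInv
    (div_misFixed_mem_slitPlane (Real.pi_pos.trans_le (pi_le_ray_im (growth_nonneg hx))))
  have h2 := hc.tendsto.comp (tendsto_rayApprox (growth_nonneg hx))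
  refine tendsto_nhds_unique (h1.congr fun n => ?_) h2
  simp only [Function.comp_apply, rayApprox]
  rw [Function.iterate_succ_apply', Function.iterate_succ_apply]

theorem ray_eq_iterate {x : ℝ} (hx : 0 ≤ x) (n : ℕ) : ray x = misInv^[n] (ray (growth^[n] x)) := by
  induction n with
  | zero => rfl
  | succ n ih =>
    rw [ih, ray_eq (iterate_growth_nonneg hx n), Function.iterate_succ_apply,
      Function.iterate_succ_apply' growth]

theorem ray_im_mem {x : ℝ} (hx : 0 ≤ x) :
    3 * Real.pi / 2 < (ray x).im ∧ (ray x).im < 5 * Real.pi / 2 := by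
  rw [ray_eq hx]
  exact misInv_im_mem (Real.pi_pos.trans_le (pi_le_ray_im (growth_nonneg hx)))

theorem ray_ne_zero {x : ℝ} (hx : 0 ≤ x) : ray x ≠ 0 := fun h => by
  have := pi_le_ray_im hx
  rw [h, zero_im] at this
  linarith [Real.pi_pos]

theorem misMap_ray {x : ℝ} (hx : 0 ≤ x) : misMap (ray x) = ray (growth x) := by
  rw [ray_eq hx, misMap_misInv (ray_ne_zero (growth_nonneg hx))]

theorem iterate_misMap_ray {x : ℝ} (hx : 0 ≤ x) (n : ℕ) :
    misMap^[n] (ray x) = ray (growth^[n] x) := by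
  induction n generalizing x with
  | zero => rfl
  | succ n ih =>
    rw [Function.iterate_succ_apply, misMap_ray hx, ih (growth_nonneg hx),
      Function.iterate_succ_apply]

theorem abs_ray_re_sub_le {x : ℝ} (hx : 0 ≤ x) : |(ray x).re - x| ≤ 5 := by
  have h := dist_rayApprox_ray_le hx 0
  rw [dist_comm, dist_eq_norm] at h
  have h2 := (abs_re_le_norm _).trans h
  simpa [rayApprox] using h2

theorem ray_zero : ray 0 = misFixed := by
  refine tendsto_nhds_unique (tendsto_rayApprox le_rfl) ?_
  refine tendsto_const_nhds.congr fun n => ?_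
  have h1 : growth^[n] 0 = 0 := Function.iterate_fixed growth_zero n
  rw [rayApprox, h1, ofReal_zero, zero_add, Function.iterate_fixed misInv_misFixed n]

theorem continuousOn_iterate_misInv (n : ℕ) :
    ContinuousOn misInv^[n] {w | Real.pi ≤ w.im} := by
  induction n with
  | zero => exact continuousOn_id
  | succ n ih =>
    rw [Function.iterate_succ']
    intro w hw
    exact (continuousAt_misInv (div_misFixed_mem_slitPlane
      (Real.pi_pos.trans_le (pi_le_iterate_misInv_im hw n)))).comp_continuousWithinAt (ih w hw)

theorem continuous_rayApprox (n : ℕ) : Continuous (rayApprox n) := by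
  have h1 : Continuous fun x : ℝ => ((growth^[n] x : ℝ) : ℂ) + misFixed :=
    (continuous_ofReal.comp (continuous_growth.iterate n)).add continuous_const
  exact (continuousOn_iterate_misInv n).comp_continuous h1 fun x => pi_le_im_ofReal_add _

theorem continuousOn_ray : ContinuousOn ray (Set.Ici 0) := by
  have h : TendstoUniformlyOn rayApprox ray atTop (Set.Ici 0) := by
    rw [Metric.tendstoUniformlyOn_iff]
    intro ε hε
    have h0 : Tendsto (fun n : ℕ => 5 * Real.pi⁻¹ ^ n) atTop (𝓝 (5 * 0)) :=
      (tendsto_pow_atTop_nhds_zero_of_lt_one (inv_nonneg.2 Real.pi_pos.le)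
        (by linarith [pi_inv_lt])).const_mul 5
    rw [mul_zero] at h0
    filter_upwards [h0.eventually (gt_mem_nhds hε)] with n hn x hx
    rw [dist_comm]
    exact (dist_rayApprox_ray_le hx n).trans_lt hn
  exact h.continuousOn (Eventually.of_forall fun n => (continuous_rayApprox n).continuousOn).frequently

theorem neg_one_lt_ray_re {x : ℝ} (hx : 0 ≤ x) : -1 < (ray x).re := by
  rw [ray_eq hx]
  exact neg_one_lt_misInv_re (ray_im_mem (growth_nonneg hx)).1

/-- The image has modulus at least `4π` but height below `5π/2`, so its real part is large in
absolute value; the bound `-1 < Re` excludes the negative sign. -/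
theorem one_le_ray_growth_re {x : ℝ} (hx : 0 ≤ x) (h : 1 ≤ (ray x).re) :
    1 ≤ (ray (growth x)).re := by
  have hpi := Real.pi_gt_three
  have h1 : 4 * Real.pi ≤ ‖ray (growth x)‖ := by
    rw [← misMap_ray hx, misMap, norm_mul, norm_misFixed, norm_exp]
    nlinarith [Real.add_one_le_exp (ray x).re]
  have h2 := norm_le_abs_re_add_abs_im (ray (growth x))
  have h3 := ray_im_mem (growth_nonneg hx)
  rw [abs_of_pos (by linarith : 0 < (ray (growth x)).im)] at h2
  have h4 := neg_one_lt_ray_re (growth_nonneg hx)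
  have h5 : 1 ≤ |(ray (growth x)).re| := by linarith
  rcases le_abs.1 h5 with h | h <;> linarith

theorem arg_ray_sub_neg {x : ℝ} (hx : 0 ≤ x) (h : 1 ≤ (ray x).re) :
    arg (ray x - misFixed) < 0 := by
  have h1 := misInv_im_lt (zero_lt_one.trans_le (one_le_ray_growth_re hx h))
  rw [← ray_eq hx] at h1
  rw [arg_neg_iff]
  simpa using h1

theorem arg_ray_sub {x : ℝ} (hx : 0 ≤ x) (h : 1 ≤ (ray x).re) :
    arg (ray x - misFixed) =
      arg (ray (growth x) - misFixed) + (misQuot (ray (growth x))).im := by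
  have h1 := one_le_ray_growth_re hx h
  have h2 := ray_im_mem (growth_nonneg hx)
  have h3 := ray_eq hx
  rw [h3]
  refine arg_misInv_sub (by linarith [Real.pi_pos]) (by linarith) ?_
  rw [← h3]; linarith

/-! ### The separating curve -/

theorem mem_escapingSet_iff_apply {f : ℂ → ℂ} {z : ℂ} :
    z ∈ escapingSet f ↔ f z ∈ escapingSet f := by
  refine ⟨fun h => mapsTo_escapingSet f h, fun h => ?_⟩
  exact (tendsto_add_atTop_iff_nat (f := fun n => ‖f^[n] z‖) 1).1 h

theorem sub_misFixed_mem_escapingSet {w : ℂ} (hw : w ∈ escapingSet misMap) :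
    w - misFixed ∈ escapingSet misMap := by
  rw [mem_escapingSet_iff_apply, misMap_sub_misFixed, ← mem_escapingSet_iff_apply]
  exact hw

theorem ray_mem_escapingSet {x : ℝ} (hx : 0 < x) : ray x ∈ escapingSet misMap := by
  have h : Tendsto (fun n => growth^[n] x + -5) atTop atTop :=
    tendsto_atTop_add_const_right _ _ (tendsto_iterate_growth hx)
  refine tendsto_atTop_mono (fun n => ?_) h
  rw [iterate_misMap_ray hx.le]
  have h1 := abs_le.1 (abs_ray_re_sub_le (iterate_growth_nonneg hx.le n))
  linarith [re_le_norm (ray (growth^[n] x)), h1.1]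

/-- A curve in the escaping set of `misMap` that runs below `2πi`, above `0`, and whose real part
tends to `-∞` and `+∞` at its two ends. -/
structure IsSeparatingCurve (γ : ℝ → ℂ) : Prop where
  continuousOn : ContinuousOn γ (Set.Ioi 0)
  mem_escapingSet : ∀ x > 0, γ x ∈ escapingSet misMap
  im_lt : ∀ x > 0, (γ x).im < 2 * Real.pi
  im_pos : ∀ x > 0, (γ x).re = 0 → 0 < (γ x).im
  tendsto_zero : Tendsto (fun x => (γ x).re) (𝓝[>] 0) atBot
  tendsto_atTop : Tendsto (fun x => (γ x).re) atTop atTop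

theorem ray_re_atTop : Tendsto (fun x => (ray x).re) atTop atTop := by
  refine tendsto_atTop_mono' atTop ?_ (tendsto_atTop_add_const_right _ (-5) tendsto_id)
  filter_upwards [eventually_ge_atTop 0] with x hx
  have := (abs_le.1 (abs_ray_re_sub_le hx)).1
  simp only [id]
  linarith

/-- Here `ℓ` supplies a continuous logarithm of `ray - 2πi`. Its normalised imaginary part `θ` is
negative far out, and each step back towards the landing point adds `Im misQuot < 0`, so it stays
negative however the ray spirals. -/
theorem exists_isSeparatingCurve {ℓ : ℂ → ℂ} (hℓ : ContinuousOn ℓ (escapingSet misMap))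
    (hexp : ∀ w ∈ escapingSet misMap, exp (ℓ w) = w) : ∃ γ, IsSeparatingCurve γ := by
  have hpi := Real.pi_gt_three
  have hrc : ContinuousOn ray (Set.Ioi 0) := continuousOn_ray.mono Set.Ioi_subset_Ici_self
  set d : ℝ → ℂ := fun x => ℓ (ray x - misFixed) with hd
  have hmem : ∀ x > 0, ray x - misFixed ∈ escapingSet misMap := fun x hx =>
    sub_misFixed_mem_escapingSet (ray_mem_escapingSet hx)
  have hdexp : ∀ x > 0, exp (d x) = ray x - misFixed := fun x hx => hexp _ (hmem x hx)
  have hdc : ContinuousOn d (Set.Ioi 0) :=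
    hℓ.comp (hrc.sub continuousOn_const) fun x hx => hmem x hx
  have hgr : Set.MapsTo growth (Set.Ioi 0) (Set.Ioi 0) := fun x hx => growth_pos hx
  have hsl : ∀ x > 0, ray (growth x) / misFixed ∈ slitPlane := fun x hx =>
    div_misFixed_mem_slitPlane
      (Real.pi_pos.trans_le (pi_le_ray_im (growth_nonneg (le_of_lt hx))))
  -- Both functions are continuous logarithms of `ray x - 2πi`.
  obtain ⟨m, hm⟩ := exists_int_of_exp_eq_exp isPreconnected_Ioi ⟨(1 : ℝ), Set.mem_Ioi.2 one_pos⟩ hdc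
    (b := fun x => d (growth x) + misQuot (ray (growth x)))
    ((hdc.comp continuous_growth.continuousOn hgr).add fun x hx =>
      (continuousAt_misQuot (hsl x hx)).comp_continuousWithinAt (f := fun x => ray (growth x))
        ((hrc.comp continuous_growth.continuousOn hgr) x hx))
    (fun x hx => by
      rw [hdexp x hx, exp_add, hdexp _ (growth_pos hx), ray_eq (le_of_lt hx),
        misInv_sub_misFixed (hsl x hx)])
  have hbig : ∀ x ≥ (6 : ℝ), 1 ≤ (ray x).re := fun x hx => by
    linarith [(abs_le.1 (abs_ray_re_sub_le (by linarith : 0 ≤ x))).1]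
  have h60 : Set.Ici (6 : ℝ) ⊆ Set.Ioi 0 := fun x hx =>
    lt_of_lt_of_le (by norm_num : (0 : ℝ) < 6) hx
  obtain ⟨c, hc⟩ := exists_int_of_exp_eq_exp isPreconnected_Ici ⟨(6 : ℝ), Set.self_mem_Ici⟩
    (a := d) (b := fun x => log (ray x - misFixed))
    (hdc.mono h60)
    (fun x hx => by
      refine ContinuousWithinAt.clog ?_ (Or.inl ?_)
      · exact ((hrc x (h60 hx)).mono h60).sub continuousWithinAt_const
      · simpa using zero_lt_one.trans_le (hbig x hx))
    (fun x hx => by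
      rw [hdexp x (h60 hx), exp_log (sub_misFixed_ne_zero (zero_lt_one.trans_le (hbig x hx)))])
  set θ : ℝ → ℝ := fun x => (d x).im - c * (2 * Real.pi) with hθ
  have hθ6 : ∀ x ≥ (6 : ℝ), θ x = arg (ray x - misFixed) := fun x hx => by
    have := congrArg im (hc x hx)
    simp [log_im] at this
    simp [hθ, this]
  have hθm : ∀ x > 0, θ x = θ (growth x) + (misQuot (ray (growth x))).im + m * (2 * Real.pi) :=
    fun x hx => by
      have := congrArg im (hm x hx)
      simp at this
      simp [hθ, this]
      ring
  -- At `x = 6` both values of `θ` are principal arguments, where `arg_ray_sub` holds without a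
  -- multiple of `2π`.
  have hm0 : (m : ℝ) * (2 * Real.pi) = 0 := by
    have h6 : (6 : ℝ) ≤ growth 6 := by linarith [two_mul_le_growth (x := 6) (by norm_num)]
    have h1 := hθm 6 (by norm_num)
    rw [hθ6 6 le_rfl, hθ6 _ h6, arg_ray_sub (by norm_num) (hbig 6 le_rfl)] at h1
    linarith
  have hθs : ∀ x > 0, θ x = θ (growth x) + (misQuot (ray (growth x))).im := fun x hx => by
    rw [hθm x hx, hm0, add_zero]
  -- Facts about `θ` on `[6, ∞)` spread to all `x > 0` by induction on the number of steps needed to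
  -- pass `6`.
  have hreach : ∀ x > 0, ∃ n, 6 ≤ growth^[n] x := fun x hx =>
    ((tendsto_iterate_growth hx).eventually_ge_atTop 6).exists
  have hθarg : ∀ x > 0, 1 ≤ (ray x).re → θ x = arg (ray x - misFixed) := by
    have : ∀ n : ℕ, ∀ x > 0, 6 ≤ growth^[n] x → 1 ≤ (ray x).re →
        θ x = arg (ray x - misFixed) := by
      intro n
      induction n with
      | zero => exact fun x _ h _ => hθ6 x h
      | succ n ih =>
        intro x hx h h1
        rw [hθs x hx, arg_ray_sub (le_of_lt hx) h1,
          ih _ (growth_pos hx) h (one_le_ray_growth_re (le_of_lt hx) h1)]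
    intro x hx h
    obtain ⟨n, hn⟩ := hreach x hx
    exact this n x hx hn h
  have hθneg : ∀ x > 0, θ x < 0 := by
    have : ∀ n : ℕ, ∀ x > 0, 6 ≤ growth^[n] x → θ x < 0 := by
      intro n
      induction n with
      | zero =>
        intro x hx h
        rw [hθ6 x h]
        exact arg_ray_sub_neg (le_of_lt hx) (hbig x h)
      | succ n ih =>
        intro x hx h
        have h1 := ih _ (growth_pos hx) h
        have h2 := (misQuot_im_mem (Real.pi_pos.trans_le
          (pi_le_ray_im (growth_nonneg (le_of_lt hx))))).2
        rw [hθs x hx]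
        linarith
    intro x hx
    obtain ⟨n, hn⟩ := hreach x hx
    exact this n x hx hn
  -- The shift by `1 - c` makes `Im γ = θ + 2π - π/2`, which selects the preimage just below `2πi`.
  set γ : ℝ → ℂ := fun x => d x - log misFixed + (1 - c : ℤ) * (2 * Real.pi * I) with hγ
  have hγim : ∀ x, (γ x).im = θ x + 3 * Real.pi / 2 := fun x => by
    simp [hγ, hθ, log_im, arg_misFixed]
    ring
  have hγexp : ∀ x > 0, misMap (γ x) = ray x - misFixed := fun x hx => by
    rw [misMap, hγ]
    simp only
    rw [exp_add, exp_int_mul_two_pi_mul_I, mul_one, exp_sub, exp_log misFixed_ne_zero, hdexp x hx,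
      mul_div_cancel₀ _ misFixed_ne_zero]
  have hγre : ∀ x > 0, (γ x).re = Real.log ‖ray x - misFixed‖ - Real.log (2 * Real.pi) := by
    intro x hx
    rw [← hdexp x hx, norm_exp, Real.log_exp]
    simp [hγ, log_re]
  refine ⟨γ, ?_, fun x hx => ?_, fun x hx => ?_, fun x hx h => ?_, ?_, ?_⟩
  · exact (hdc.sub continuousOn_const).add continuousOn_const
  · rw [mem_escapingSet_iff_apply, hγexp x hx]
    exact hmem x hx
  · rw [hγim]
    linarith [hθneg x hx]
  · have hne : ray x - misFixed ≠ 0 := by rw [← hdexp x hx]; exact exp_ne_zero _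
    -- On this circle the height is at most `π/2`, so `Re (ray x) ≥ 1`; there `θ` is a principal
    -- argument above `-π/2`.
    have h1 : ‖ray x - misFixed‖ = 2 * Real.pi := by
      rw [hγre x hx, sub_eq_zero] at h
      exact Real.log_injOn_pos (norm_pos_iff.2 hne) Real.two_pi_pos h
    have h2 := norm_le_abs_re_add_abs_im (ray x - misFixed)
    have h3 := ray_im_mem (le_of_lt hx)
    have h4 : |(ray x - misFixed).im| ≤ Real.pi / 2 := by
      rw [sub_im, misFixed_im, abs_le]
      constructor <;> linarith [h3.1, h3.2]
    rw [sub_re, misFixed_re, sub_zero] at h2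
    have h5 : 1 ≤ |(ray x).re| := by linarith
    have h6 : 1 ≤ (ray x).re := by
      rcases le_abs.1 h5 with h | h
      · exact h
      · linarith [neg_one_lt_ray_re (le_of_lt hx)]
    have h7 := (abs_arg_sub_misFixed_lt (zero_lt_one.trans_le h6)).1
    rw [hγim, hθarg x hx h6]
    linarith
  · have h0 : Tendsto ray (𝓝[>] 0) (𝓝 misFixed) := by
      have := continuousOn_ray 0 Set.self_mem_Ici
      rw [ContinuousWithinAt, ray_zero] at this
      exact this.mono_left (nhdsWithin_mono _ Set.Ioi_subset_Ici_self)
    have h1 : Tendsto (fun x => ‖ray x - misFixed‖) (𝓝[>] 0) (𝓝[>] 0) := by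
      refine tendsto_nhdsWithin_iff.2 ⟨?_, ?_⟩
      · simpa using (h0.sub_const misFixed).norm
      · filter_upwards [self_mem_nhdsWithin] with x hx
        rw [Set.mem_Ioi, norm_pos_iff, ← hdexp x hx]
        exact exp_ne_zero _
    have h2 := tendsto_atBot_add_const_right _ (-Real.log (2 * Real.pi))
      (Real.tendsto_log_nhdsGT_zero.comp h1)
    refine h2.congr' ?_
    filter_upwards [self_mem_nhdsWithin] with x hx
    rw [hγre x hx, sub_eq_add_neg, Function.comp_apply]
  · have h1 : Tendsto (fun x => ‖ray x - misFixed‖) atTop atTop :=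
      tendsto_atTop_mono (fun x => by simpa using re_le_norm (ray x - misFixed)) ray_re_atTop
    have h2 := tendsto_atTop_add_const_right _ (-Real.log (2 * Real.pi))
      (Real.tendsto_log_atTop.comp h1)
    refine h2.congr' ?_
    filter_upwards [eventually_gt_atTop 0] with x hx
    rw [hγre x hx, sub_eq_add_neg, Function.comp_apply]

/-! ### Pullbacks of a separating curve and their winding around `2πi` -/

namespace IsSeparatingCurve

variable {γ : ℝ → ℂ}

theorem div_mem_slitPlane (h : IsSeparatingCurve γ) {x : ℝ} (hx : 0 < x) :
    γ x / misFixed ∈ slitPlane := by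
  rw [mem_slitPlane_iff, div_misFixed_re, div_misFixed_im]
  by_cases h0 : (γ x).re = 0
  · exact Or.inl (div_pos (h.im_pos x hx h0) Real.two_pi_pos)
  · exact Or.inr (div_ne_zero (neg_ne_zero.2 h0) Real.two_pi_pos.ne')

theorem sub_im_neg (h : IsSeparatingCurve γ) {x : ℝ} (hx : 0 < x) :
    (γ x - misFixed).im < 0 := by
  simpa using h.im_lt x hx

/-- The lift of a separating curve under the inverse branch. -/
noncomputable def lift (γ : ℝ → ℂ) (n : ℕ) (x : ℝ) : ℂ := misInv^[n] (misInv (γ x))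

/-- A continuous logarithm of `lift γ n - 2πi`. -/
noncomputable def liftLog (γ : ℝ → ℂ) (n : ℕ) (x : ℝ) : ℂ :=
  log (γ x - misFixed) + misQuot (γ x) + ∑ j ∈ Finset.range n, misQuot (lift γ j x)

theorem lift_succ (n : ℕ) (x : ℝ) : lift γ (n + 1) x = misInv (lift γ n x) := by
  rw [lift, Function.iterate_succ_apply', lift]

theorem liftLog_succ (n : ℕ) (x : ℝ) :
    liftLog γ (n + 1) x = liftLog γ n x + misQuot (lift γ n x) := by
  rw [liftLog, Finset.sum_range_succ, ← add_assoc, liftLog]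

theorem lift_zero_im (x : ℝ) :
    Real.pi < (lift γ 0 x).im ∧ (lift γ 0 x).im ≤ 3 * Real.pi := by
  have h1 := neg_pi_lt_arg (γ x / misFixed)
  have h2 := arg_le_pi (γ x / misFixed)
  rw [show lift γ 0 x = misInv (γ x) from rfl, misInv_im]
  constructor <;> linarith

theorem pi_le_lift_im (x : ℝ) (n : ℕ) :
    Real.pi ≤ (lift γ n x).im :=
  pi_le_iterate_misInv_im (lift_zero_im (γ := γ) x).1.le n

theorem lift_div_mem_slitPlane (x : ℝ) (n : ℕ) :
    lift γ n x / misFixed ∈ slitPlane :=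
  div_misFixed_mem_slitPlane (Real.pi_pos.trans_le (pi_le_lift_im x n))

theorem exp_liftLog (h : IsSeparatingCurve γ) {x : ℝ} (hx : 0 < x) (n : ℕ) :
    exp (liftLog γ n x) = lift γ n x - misFixed := by
  induction n with
  | zero =>
    have hne : γ x - misFixed ≠ 0 := fun h0 => by
      have := h.sub_im_neg hx
      simp [h0] at this
    rw [liftLog, Finset.sum_range_zero, add_zero, exp_add, exp_log hne,
      ← misInv_sub_misFixed (h.div_mem_slitPlane hx)]
    rfl
  | succ n ih =>
    rw [liftLog_succ, exp_add, ih, lift_succ, misInv_sub_misFixed (lift_div_mem_slitPlane x n)]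

theorem continuousOn_lift (h : IsSeparatingCurve γ) (n : ℕ) :
    ContinuousOn (lift γ n) (Set.Ioi 0) := by
  induction n with
  | zero =>
    exact fun x hx => (continuousAt_misInv (h.div_mem_slitPlane hx)).comp_continuousWithinAt
      (f := γ) (h.continuousOn x hx)
  | succ n ih =>
    intro x hx
    have := (continuousAt_misInv (lift_div_mem_slitPlane x n)).comp_continuousWithinAt
      (f := lift γ n) (ih x hx)
    exact this.congr (fun y _ => lift_succ n y) (lift_succ n x)

theorem continuousOn_liftLog (h : IsSeparatingCurve γ) (n : ℕ) :
    ContinuousOn (liftLog γ n) (Set.Ioi 0) := by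
  refine ContinuousOn.add (ContinuousOn.add ?_ ?_) (continuousOn_finsetSum _ fun j _ => ?_)
  · exact (h.continuousOn.sub continuousOn_const).clog fun x hx => Or.inr (h.sub_im_neg hx).ne
  · exact fun x hx => (continuousAt_misQuot (h.div_mem_slitPlane hx)).comp_continuousWithinAt
      (f := γ) (h.continuousOn x hx)
  · exact fun x hx => (continuousAt_misQuot (lift_div_mem_slitPlane x j)).comp_continuousWithinAt
      (f := lift γ j) (h.continuousOn_lift j x hx)

theorem lift_mem_escapingSet (h : IsSeparatingCurve γ) {x : ℝ} (hx : 0 < x) (n : ℕ) :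
    lift γ n x ∈ escapingSet misMap := by
  have key : ∀ w ∈ escapingSet misMap, w / misFixed ∈ slitPlane →
      misInv w ∈ escapingSet misMap := fun w hw hs => by
    rw [mem_escapingSet_iff_apply, misMap_misInv]
    · exact hw
    · rintro rfl
      simp at hs
  induction n with
  | zero => exact key _ (h.mem_escapingSet x hx) (h.div_mem_slitPlane hx)
  | succ n ih =>
    rw [lift_succ]
    exact key _ ih (lift_div_mem_slitPlane x n)

theorem exists_log_eq_liftLog (h : IsSeparatingCurve γ) {ℓ : ℂ → ℂ}
    (hℓ : ContinuousOn ℓ (escapingSet misMap))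
    (hexp : ∀ w ∈ escapingSet misMap, exp (ℓ w) = w) (n : ℕ) :
    ∃ k : ℤ, ∀ x > 0, ℓ (lift γ n x - misFixed) = liftLog γ n x + k * (2 * Real.pi * I) := by
  have hm : ∀ x > 0, lift γ n x - misFixed ∈ escapingSet misMap := fun x hx =>
    sub_misFixed_mem_escapingSet (h.lift_mem_escapingSet hx n)
  exact exists_int_of_exp_eq_exp isPreconnected_Ioi ⟨(1 : ℝ), Set.mem_Ioi.2 one_pos⟩
    (hℓ.comp ((h.continuousOn_lift n).sub continuousOn_const) fun x hx => hm x hx)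
    (h.continuousOn_liftLog n) fun x hx => by
      rw [hexp _ (hm x hx), h.exp_liftLog hx]

theorem tendsto_lift_zero_re {l : Filter ℝ} (hl : Tendsto (fun x => ‖γ x‖) l atTop) :
    Tendsto (fun x => (lift γ 0 x).re) l atTop := by
  have := Real.tendsto_log_atTop.comp (hl.atTop_div_const Real.two_pi_pos)
  exact this.congr fun x => (misInv_re _).symm

theorem continuousOn_lift_zero_re (h : IsSeparatingCurve γ) :
    ContinuousOn (fun x => (lift γ 0 x).re) (Set.Ioi 0) :=
  continuous_re.comp_continuousOn (h.continuousOn_lift 0)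

/-- Intermediate values: `Re (misInv w) = log (‖w‖ / 2π)` tends to `+∞` also at the left end of `γ`.
-/
theorem exists_left (h : IsSeparatingCurve γ) :
    ∀ᶠ r in atTop, ∃ x > 0, (γ x).re < 0 ∧ (lift γ 0 x).re = r := by
  obtain ⟨x₀, hx₀, hs⟩ :=
    mem_nhdsGT_iff_exists_Ioc_subset.1 (h.tendsto_zero.eventually (eventually_lt_atBot 0))
  have hx₀' : (0 : ℝ) < x₀ := hx₀
  have ht := tendsto_lift_zero_re (tendsto_atTop_mono (fun x => abs_re_le_norm (γ x))
    (tendsto_abs_atBot_atTop.comp h.tendsto_zero))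
  have hiv := isPreconnected_Ioc.intermediate_value_Ici (s := Set.Ioc 0 x₀) ⟨hx₀', le_rfl⟩
    (le_principal_iff.2 (Ioc_mem_nhdsGT hx₀'))
    (h.continuousOn_lift_zero_re.mono fun x hx => hx.1) ht
  filter_upwards [eventually_ge_atTop ((lift γ 0 x₀).re)] with r hr
  obtain ⟨x, hx, hxr⟩ := hiv hr
  exact ⟨x, hx.1, hs hx, hxr⟩

theorem exists_right (h : IsSeparatingCurve γ) :
    ∀ᶠ r in atTop, ∃ x > 0, 0 < (γ x).re ∧ (lift γ 0 x).re = r := by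
  obtain ⟨x₀, hs⟩ := eventually_atTop.1
    ((h.tendsto_atTop.eventually (eventually_gt_atTop 0)).and (eventually_gt_atTop 0))
  have ht := tendsto_lift_zero_re (tendsto_atTop_mono (fun x => re_le_norm (γ x))
    h.tendsto_atTop)
  have hiv := intermediate_value_Ici
    (h.continuousOn_lift_zero_re.mono fun x hx => (hs x hx).2 : ContinuousOn _ (Set.Ici x₀)) ht
  filter_upwards [eventually_ge_atTop ((lift γ 0 x₀).re)] with r hr
  obtain ⟨x, hx, hxr⟩ := hiv hr
  exact ⟨x, (hs x hx).2, (hs x hx).1, hxr⟩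

/-- At level `0` the real parts agree and the heights differ by at most `3π/2 < 5`; then `misInv`
contracts. -/
theorem norm_lift_sub_ray_le {x y : ℝ} (hy : 0 ≤ y) {n : ℕ}
    (hr : (lift γ 0 x).re = (ray (growth^[n] y)).re) {j : ℕ} (hj : j ≤ n) :
    ‖lift γ j x - ray (growth^[n - j] y)‖ ≤ Real.pi⁻¹ ^ j * 5 := by
  have hn := iterate_growth_nonneg hy n
  have h1 : growth^[j] (growth^[n - j] y) = growth^[n] y := by
    rw [← Function.iterate_add_apply, Nat.add_sub_cancel' hj]
  rw [ray_eq_iterate (iterate_growth_nonneg hy _) j, h1]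
  refine (norm_iterate_misInv_sub_le (lift_zero_im (γ := γ) x).1.le (pi_le_ray_im hn) j).trans ?_
  refine mul_le_mul_of_nonneg_left ?_ (pow_nonneg (inv_nonneg.2 Real.pi_pos.le) j)
  change ‖lift γ 0 x - ray (growth^[n] y)‖ ≤ 5
  refine (norm_le_abs_re_add_abs_im _).trans ?_
  rw [sub_re, hr, sub_self, abs_zero, zero_add, sub_im, abs_le]
  have h2 := lift_zero_im (γ := γ) x
  have h3 := ray_im_mem hn
  constructor <;> linarith [Real.pi_lt_d2, h2.1, h2.2, h3.1, h3.2]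

theorem lift_re_pos {x y : ℝ} (hy : 20 ≤ y) {n : ℕ}
    (hr : (lift γ 0 x).re = (ray (growth^[n] y)).re) {j : ℕ} (hj : j ≤ n) :
    0 < (lift γ j x).re := by
  have hy0 : 0 ≤ y := by linarith
  have h1 := norm_lift_sub_ray_le hy0 hr hj
  have h2 : Real.pi⁻¹ ^ j ≤ 1 :=
    pow_le_one₀ (inv_nonneg.2 Real.pi_pos.le) (by linarith [pi_inv_lt])
  have h3 := (abs_le.1 ((abs_re_le_norm _).trans h1)).1
  have h4 := (abs_le.1 (abs_ray_re_sub_le (iterate_growth_nonneg hy0 (n - j)))).1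
  have h5 := le_iterate_growth hy0 (n - j)
  rw [sub_re] at h3
  linarith

/-- Within the right half plane both terms gain the same `Im misQuot` at each step, so the winding
at level `0` persists. -/
theorem liftLog_im_sub_arg {x : ℝ} {n : ℕ}
    (hpos : ∀ j ≤ n, 0 < (lift γ j x).re) :
    (liftLog γ n x).im - arg (lift γ n x - misFixed) =
      (liftLog γ 0 x).im - arg (lift γ 0 x - misFixed) := by
  induction n with
  | zero => rfl
  | succ n ih =>
    have hp := hpos (n + 1) le_rfl
    rw [lift_succ] at hp
    rw [← ih fun j hj => hpos j (hj.trans n.le_succ), liftLog_succ, add_im, lift_succ,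
      arg_misInv_sub (Real.pi_pos.trans_le (pi_le_lift_im x n)) (hpos n n.le_succ) hp]
    ring

theorem liftLog_zero_im (x : ℝ) : (liftLog γ 0 x).im =
    arg (γ x - misFixed) + arg (logSlope (γ x / misFixed)) - Real.pi / 2 := by
  rw [liftLog, Finset.sum_range_zero, add_zero, add_im, log_im, misQuot_im]
  ring

/-- The difference is a multiple of `2π`. On the left both arguments in `liftLog_zero_im` are
negative, which makes it negative. -/
theorem liftLog_zero_im_left (h : IsSeparatingCurve γ) {x : ℝ} (hx : 0 < x) (hl : (γ x).re < 0)
    (hU : 0 < (lift γ 0 x).re) :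
    (liftLog γ 0 x).im - arg (lift γ 0 x - misFixed) ≤ -(2 * Real.pi) := by
  obtain ⟨k, hk⟩ := exists_im_eq_arg_add (h.exp_liftLog hx 0)
  have h1 := arg_neg_iff.2 (h.sub_im_neg hx)
  have h2 : arg (logSlope (γ x / misFixed)) < 0 := by
    refine arg_neg_iff.2 (logSlope_im_neg ?_)
    rw [div_misFixed_im]
    exact div_pos (by linarith) Real.two_pi_pos
  have h3 := (abs_arg_sub_misFixed_lt hU).1
  have h4 := liftLog_zero_im (γ := γ) x
  have h5 : (k : ℝ) * (2 * Real.pi) < 0 := by linarith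
  have h6 : (k : ℝ) < 0 := by nlinarith [Real.two_pi_pos]
  have h7 : (k : ℝ) ≤ -1 := by
    have : k < 0 := by exact_mod_cast h6
    exact_mod_cast (by omega : k ≤ -1)
  nlinarith [Real.two_pi_pos]

/-- On the right the two arguments have opposite tendencies, and the multiple of `2π` is confined to
`(-2π, 2π)`. -/
theorem liftLog_zero_im_right (h : IsSeparatingCurve γ) {x : ℝ} (hx : 0 < x) (hl : 0 < (γ x).re)
    (hU : 0 < (lift γ 0 x).re) :
    (liftLog γ 0 x).im - arg (lift γ 0 x - misFixed) = 0 := by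
  obtain ⟨k, hk⟩ := exists_im_eq_arg_add (h.exp_liftLog hx 0)
  have h1 := arg_neg_iff.2 (h.sub_im_neg hx)
  have h1' := neg_pi_lt_arg (γ x - misFixed)
  have h2 : 0 ≤ arg (logSlope (γ x / misFixed)) := by
    refine arg_nonneg_iff.2 (logSlope_im_pos ?_).le
    rw [div_misFixed_im]
    exact div_neg_of_neg_of_pos (by linarith) Real.two_pi_pos
  have h2' := arg_le_pi (logSlope (γ x / misFixed))
  have h3 := abs_arg_sub_misFixed_lt hU
  have h4 := liftLog_zero_im (γ := γ) x
  have hk0 := int_eq_zero_of_abs_lt (k := k) (by linarith) (by linarith [Real.pi_pos])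
  rw [hk, hk0]
  simp

end IsSeparatingCurve

/-! ### No continuous logarithm on the escaping set -/

open IsSeparatingCurve in
theorem not_exists_continuousOn_log_escapingSet {ℓ : ℂ → ℂ}
    (hℓ : ContinuousOn ℓ (escapingSet misMap)) :
    ¬ ∀ w ∈ escapingSet misMap, exp (ℓ w) = w := by
  intro hexp
  obtain ⟨γ, h⟩ := exists_isSeparatingCurve hℓ hexp
  have hray := abs_le.1 (abs_ray_re_sub_le (x := 20) (by norm_num))
  set q := ray 20 - misFixed with hq
  have hqJ : q ∈ escapingSet misMap :=
    sub_misFixed_mem_escapingSet (ray_mem_escapingSet (by norm_num))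
  have hqs : q ∈ slitPlane := Or.inl (by simp [hq]; linarith [hray.1])
  obtain ⟨δ₁, hδ₁, hd₁⟩ := Metric.continuousWithinAt_iff.1 (hℓ q hqJ) (1 / 2) (by norm_num)
  obtain ⟨δ₂, hδ₂, hd₂⟩ := Metric.continuousAt_iff.1 (continuousAt_arg hqs) (1 / 2) (by norm_num)
  have hlim : Tendsto (fun n : ℕ => Real.pi⁻¹ ^ n * 5) atTop (𝓝 (0 * 5)) :=
    (tendsto_pow_atTop_nhds_zero_of_lt_one (inv_nonneg.2 Real.pi_pos.le)
      (by linarith [pi_inv_lt])).mul_const 5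
  rw [zero_mul] at hlim
  have hR : Tendsto (fun n => (ray (growth^[n] 20)).re) atTop atTop :=
    ray_re_atTop.comp (tendsto_iterate_growth (by norm_num))
  -- `a` and `b` lie on opposite ends of `γ`, and their level `0` lifts share the real part of the
  -- `n`-th image of `ray 20`.
  obtain ⟨n, ⟨a, ha, hal, har⟩, ⟨b, hb, hbl, hbr⟩, hn⟩ :=
    ((hR.eventually h.exists_left).and ((hR.eventually h.exists_right).and
      (hlim.eventually (gt_mem_nhds (lt_min hδ₁ hδ₂))))).exists
  have key : ∀ x > 0, (lift γ 0 x).re = (ray (growth^[n] 20)).re →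
      |(ℓ (lift γ n x - misFixed)).im - (ℓ q).im| < 1 / 2 ∧
      |arg (lift γ n x - misFixed) - arg q| < 1 / 2 ∧ 0 < (lift γ 0 x).re ∧
      (liftLog γ n x).im - arg (lift γ n x - misFixed) =
        (liftLog γ 0 x).im - arg (lift γ 0 x - misFixed) := by
    intro x hx hr
    have h1 := norm_lift_sub_ray_le (by norm_num) hr le_rfl
    rw [Nat.sub_self, Function.iterate_zero, id] at h1
    have h2 : dist (lift γ n x - misFixed) q < min δ₁ δ₂ := by
      rw [hq, dist_sub_right, dist_eq_norm]
      exact h1.trans_lt hn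
    have h3 := hd₁ (sub_misFixed_mem_escapingSet (h.lift_mem_escapingSet hx n))
      (h2.trans_le (min_le_left _ _))
    have h4 := hd₂ (h2.trans_le (min_le_right _ _))
    have hpos : ∀ j ≤ n, 0 < (lift γ j x).re := fun j hj => lift_re_pos le_rfl hr hj
    refine ⟨?_, h4, hpos 0 n.zero_le, liftLog_im_sub_arg hpos⟩
    rw [← sub_im]
    exact (abs_im_le_norm _).trans_lt (by rwa [dist_eq_norm] at h3)
  obtain ⟨a1, a2, a3, a4⟩ := key a ha har
  obtain ⟨b1, b2, b3, b4⟩ := key b hb hbr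
  obtain ⟨k, hk⟩ := h.exists_log_eq_liftLog hℓ hexp n
  have hka := congrArg im (hk a ha)
  have hkb := congrArg im (hk b hb)
  simp only [add_im] at hka hkb
  have hA := h.liftLog_zero_im_left ha hal a3
  have hB := h.liftLog_zero_im_right hb hbl b3
  rw [abs_lt] at a1 a2 b1 b2
  -- `Im ℓ` and `arg` each differ by less than `1` between the two points, while the winding forces
  -- a discrepancy of at least `2π`.
  linarith [Real.pi_gt_three, a1.1, a1.2, a2.1, a2.2, b1.1, b1.2, b2.1, b2.2]

/-! ### Continuous sections of the two restricted maps -/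

theorem expMap_neg_two_re_nonneg {z : ℂ} (hz : z ∈ escapingSet (expMap (-2))) : 0 ≤ z.re := by
  by_contra! hneg
  have hstep : ∀ w : ℂ, w.re < 0 → (expMap (-2) w).re < 0 ∧ ‖expMap (-2) w‖ ≤ 3 := by
    intro w hw
    have h1 : ‖exp w‖ < 1 := by rw [norm_exp]; simpa using hw
    have h2 := re_le_norm (exp w)
    refine ⟨?_, ?_⟩
    · simp only [expMap, add_re, neg_re, re_ofNat]
      linarith
    · refine (norm_add_le _ _).trans ?_
      rw [norm_neg, Complex.norm_ofNat]
      linarith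
  have hre : ∀ n, ((expMap (-2))^[n] z).re < 0 := by
    intro n
    induction n with
    | zero => exact hneg
    | succ n ih => rw [Function.iterate_succ_apply']; exact (hstep _ ih).1
  obtain ⟨n, hn⟩ := (((tendsto_add_atTop_iff_nat 1).2 hz).eventually (eventually_gt_atTop 3)).exists
  rw [Function.iterate_succ_apply'] at hn
  exact absurd (hstep _ (hre n)).2 (not_le.2 hn)

/-- The principal branch of `z ↦ log (z + 2)` is a continuous section of the restriction of
`E_{-2}` to its escaping set. -/
theorem exists_continuous_section_neg_two :
    ∃ s : escapingSet (expMap (-2)) → escapingSet (expMap (-2)), Continuous s ∧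
      ∀ z, escapingRestrict (expMap (-2)) (s z) = z := by
  have hre : ∀ z : escapingSet (expMap (-2)), (z : ℂ) + 2 ∈ slitPlane := fun z =>
    Or.inl (by simpa using add_pos_of_nonneg_of_pos (expMap_neg_two_re_nonneg z.2) two_pos)
  have hsec : ∀ z : escapingSet (expMap (-2)), expMap (-2) (log ((z : ℂ) + 2)) = z := fun z => by
    rw [expMap, exp_log (slitPlane_ne_zero (hre z))]
    ring
  refine ⟨fun z => ⟨log ((z : ℂ) + 2), ?_⟩, ?_, fun z => Subtype.ext (hsec z)⟩
  · rw [mem_escapingSet_iff_apply, hsec z]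
    exact z.2
  · exact ((continuous_subtype_val.add continuous_const).clog hre).subtype_mk _

theorem misMap_mem_iff_add {κ : ℂ} (hκ : exp κ = misFixed) (w : ℂ) :
    w + κ ∈ escapingSet (expMap κ) ↔ w ∈ escapingSet misMap := by
  have hit : ∀ n, (expMap κ)^[n] (w + κ) = misMap^[n] w + κ := by
    intro n
    induction n with
    | zero => rfl
    | succ n ih =>
      rw [Function.iterate_succ_apply', ih, Function.iterate_succ_apply', expMap, exp_add, hκ,
        misMap, mul_comm]
  constructor <;> intro h
  · refine tendsto_atTop_mono (fun n => ?_) (tendsto_atTop_add_const_right _ (-‖κ‖) h)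
    rw [hit]
    linarith [norm_add_le (misMap^[n] w) κ]
  · refine tendsto_atTop_mono (fun n => ?_) (tendsto_atTop_add_const_right _ (-‖κ‖) h)
    rw [hit]
    have := norm_sub_le (misMap^[n] w + κ) κ
    rw [add_sub_cancel_right] at this
    linarith

/-- The section equation at `w + κ` reads `exp (s (w + κ)) + κ = w + κ`, so `s` is a logarithm of
`w`. -/
theorem not_exists_continuous_section {κ : ℂ} (hκ : exp κ = misFixed)
    {s : escapingSet (expMap κ) → escapingSet (expMap κ)} (hs : Continuous s) :
    ¬ ∀ z, escapingRestrict (expMap κ) (s z) = z := by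
  classical
  intro hsec
  refine not_exists_continuousOn_log_escapingSet (ℓ := fun w =>
    if h : w ∈ escapingSet misMap then (s ⟨w + κ, (misMap_mem_iff_add hκ w).2 h⟩ : ℂ) else 0)
    ?_ fun w hw => ?_
  · rw [continuousOn_iff_continuous_domRestrict]
    have : Continuous fun w : escapingSet misMap =>
        (s ⟨(w : ℂ) + κ, (misMap_mem_iff_add hκ w).2 w.2⟩ : ℂ) :=
      continuous_subtype_val.comp (hs.comp
        ((continuous_subtype_val.add continuous_const).subtype_mk _))
    refine this.congr fun w => ?_
    simp [Set.domRestrict_apply]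
  · have := congrArg Subtype.val (hsec ⟨w + κ, (misMap_mem_iff_add hκ w).2 hw⟩)
    rw [dif_pos hw]
    exact add_right_cancel (b := κ) this

theorem exp_log_two_pi_add :
    exp ((Real.log (2 * Real.pi) : ℂ) + (Real.pi / 2 : ℂ) * I) = misFixed := by
  rw [exp_add, exp_pi_div_two_mul_I, ← ofReal_exp, Real.exp_log Real.two_pi_pos, misFixed]
  push_cast
  rfl

end

theorem mainTheorem8 :
    ¬ TopologicallyConjugate
        (escapingRestrict (expMap (-2)))
        (escapingRestrict (expMap ((Real.log (2 * Real.pi) : ℂ) + (Real.pi / 2 : ℂ) * Complex.I))) := by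
  rintro ⟨Φ, hΦ⟩
  obtain ⟨s, hs, hsec⟩ := exists_continuous_section_neg_two
  refine not_exists_continuous_section exp_log_two_pi_add
    (s := fun z => Φ (s (Φ.symm z))) (Φ.continuous.comp (hs.comp Φ.symm.continuous)) fun z => ?_
  rw [← hΦ, hsec, Φ.apply_symm_apply]
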